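/- A polymatroid game consists of a finite set $N$ of $n$ players and a finite set $E$ of $m$ resources and, for every player $i\in N$, a demand $d_i\in\mathbb N=\{0,1,2,\dots\}$, an integral polymatroid rank function $f_i:2^E\to\mathbb N$ (normalized, monotone and submodular) with $d_i\le f_i(E)$, and functions $C_{i,e}:\mathbb N\times\mathbb N\to\mathbb R$, $e\in E$. Write $C^-(x;t)=C(x;t)-C(x-1;t)$ for $x\ge 1$; every $C=C_{i,e}$ is assumed to be regular, that is, $C^-(x;t)\le C^-(x;t+1)\le C^-(x+1;t)$ for all integers $x\ge 1$ and $t\ge 0$. For $k\in\mathbb N$ let $$X_i(k)=\Bigl\{x\in\mathbb N^E : \sum_{e\in U}x_e\le f_i(U)\text{ for all }U\subseteq E,\ \sum_{e\in E}x_e=k\Bigr\}.$$ The strategies of player $i$ are the elements of $X_i(d_i)$, and the private cost of player $i$ under a profile $x=(x_i)_{i\in N}$ is $\pi_i(x)=\sum_{e\in E}C_{i,e}\bigl(x_{i,e};\sum_{j\ne i}x_{j,e}\bigr)$. Consider the following algorithm, in which $\|\cdot\|$ is the $L_1$-norm and all choices are arbitrary. Start with $\bar d_i=0$ and $x_i=0$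 for all $i\in N$. For $k=1,\dots,\sum_{i\in N} d_i$: choose a player $i$ with $\bar d_i<d_i$, increase $\bar d_i$ by one, and replace $x_i$ by a best response $y_i\in X_i(\bar d_i)$ with $\|y_i-x_i\|=1$; then, while some player $i$ can strictly decrease its private cost by switching to another strategy in $X_i(\bar d_i)$, choose such a player $i$ and replace $x_i$ by a best response $y_i\in X_i(\bar d_i)$ with $\|y_i-x_i\|=2$. Finally return $x$. Then, for all possible choices, the best responses required by the algorithm always exist, the algorithm returns a pure Nash equilibrium of the game, and the total number of iterations (of the for-loop and of the while-loop together) is at most $n^2m\delta^3$, where $\delta=\max_{i\in N}d_i$ (and $\delta=0$ if $N=\emptyset$). -/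

import Mathlib

/-- Integral polymatroid rank functions: normalized, monotone, submodular, with values in `ℕ`. -/
structure IsIntegralPolymatroidRank {E : Type*} [DecidableEq E] (f : Finset E → ℕ) : Prop where
  normalized : f ∅ = 0
  monotone : ∀ U V : Finset E, U ⊆ V → f U ≤ f V
  submodular : ∀ U V : Finset E, f (U ∪ V) + f (U ∩ V) ≤ f U + f V

/-- The integral polymatroid base polyhedron of `f`, truncated at `d`. -/
def polymatroidBase {E : Type*} [Fintype E] (f : Finset E → ℕ) (d : ℕ) : Set (E → ℕ) :=
  {x | (∀ U : Finset E, ∑ e ∈ U, x e ≤ f U) ∧ ∑ e, x e = d}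

/-- The left discrete derivative in the first argument, `C (x; t) - C (x - 1; t)`. It is
meaningful for `1 ≤ x` only, and is only used for such `x`. -/
def leftDeriv (C : ℕ → ℕ → ℝ) (x t : ℕ) : ℝ := C x t - C (x - 1) t

/-- Regularity of a cost function `C (x; t)`. -/
structure IsRegularCost (C : ℕ → ℕ → ℝ) : Prop where
  mono : ∀ x t : ℕ, 1 ≤ x → leftDeriv C x t ≤ leftDeriv C x (t + 1)
  shift : ∀ x t : ℕ, 1 ≤ x → leftDeriv C x (t + 1) ≤ leftDeriv C (x + 1) t

/-- The `L₁` distance of two integral vectors. -/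
def l1Dist {E : Type*} [Fintype E] (x y : E → ℕ) : ℤ := ∑ e, |(x e : ℤ) - (y e : ℤ)|

/-- A polymatroid game with player set `N` and resource set `E`: demands `d i`, capacity functions
`f i` and costs `C i e x t`, where `x` is the player's own load and `t` the load of the others. -/
structure PolymatroidGame (N E : Type*) [Fintype N] [Fintype E] [DecidableEq E] where
  d : N → ℕ
  f : N → Finset E → ℕ
  C : N → E → ℕ → ℕ → ℝ
  rank_f : ∀ i, IsIntegralPolymatroidRank (f i)
  d_le : ∀ i, d i ≤ f i Finset.univ
  regular_C : ∀ i e, IsRegularCost (C i e)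

namespace PolymatroidGame

variable {N E : Type*} [Fintype N] [DecidableEq N] [Fintype E] [DecidableEq E]

/-- The load on `e` caused by the players other than `i`. -/
def othersLoad (x : N → E → ℕ) (i : N) (e : E) : ℕ := ∑ j ∈ Finset.univ.erase i, x j e

/-- The private cost of player `i` under the strategy profile `x`. -/
def privateCost (G : PolymatroidGame N E) (i : N) (x : N → E → ℕ) : ℝ :=
  ∑ e, G.C i e (x i e) (othersLoad x i e)

/-- `y` is a best response of player `i` to the strategies of the others in `x`, when the demand
of player `i` is `k`. -/
def IsBestResponse (G : PolymatroidGame N E) (i : N) (k : ℕ) (x : N → E → ℕ) (y : E → ℕ) : Prop :=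
  y ∈ polymatroidBase (G.f i) k ∧
    ∀ z ∈ polymatroidBase (G.f i) k,
      G.privateCost i (Function.update x i y) ≤ G.privateCost i (Function.update x i z)

/-- `x` is a pure Nash equilibrium of the game. -/
def IsPureNash (G : PolymatroidGame N E) (x : N → E → ℕ) : Prop :=
  ∀ i, G.IsBestResponse i (G.d i) x (x i)

/-- The variables of the algorithm: the preliminary demands and the preliminary strategies. -/
structure State (N E : Type*) where
  dbar : N → ℕ
  x : N → E → ℕ

/-- In the state `s`, player `i` can improve in the game with the preliminary demands. -/
def CanImprove (G : PolymatroidGame N E) (s : State N E) (i : N) : Prop :=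
  ∃ z ∈ polymatroidBase (G.f i) (s.dbar i),
    G.privateCost i (Function.update s.x i z) < G.privateCost i s.x

/-- Head of the body of the for-loop: the preliminary demand of a player `i` that is still below
its demand is increased by one, and `i` switches to a best response at distance one. -/
def IncreaseStep (G : PolymatroidGame N E) (i : N) (s s' : State N E) : Prop :=
  s.dbar i < G.d i ∧ ∃ y : E → ℕ,
    G.IsBestResponse i (s.dbar i + 1) s.x y ∧ l1Dist y (s.x i) = 1 ∧
    s' = ⟨Function.update s.dbar i (s.dbar i + 1), Function.update s.x i y⟩

/-- An iteration of the while-loop: a player `i` that can improve switches to a best response at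
distance two. -/
def ImproveStep (G : PolymatroidGame N E) (i : N) (s s' : State N E) : Prop :=
  G.CanImprove s i ∧ ∃ y : E → ℕ,
    G.IsBestResponse i (s.dbar i) s.x y ∧ l1Dist y (s.x i) = 2 ∧
    s' = ⟨s.dbar, Function.update s.x i y⟩

/-- `G.Run k l s`: some execution of the algorithm (with arbitrary choices of the players and of
the best responses) reaches the state `s` after having started exactly `k` iterations of the
for-loop and having completed, in total, exactly `l` iterations of the while-loop. A new iteration
of the for-loop starts only after the while-loop is left, that is, when nobody can improve. -/
inductive Run (G : PolymatroidGame N E) : ℕ → ℕ → State N E → Prop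
  | init : Run G 0 0 ⟨fun _ => 0, fun _ _ => 0⟩
  | increase {k l : ℕ} {s s' : State N E} (i : N) : Run G k l s → (∀ j, ¬ G.CanImprove s j) →
      k < ∑ j, G.d j → G.IncreaseStep i s s' → Run G (k + 1) l s'
  | improve {k l : ℕ} {s s' : State N E} (i : N) : Run G k l s →
      G.ImproveStep i s s' → Run G k (l + 1) s'

end PolymatroidGame

/-!
Fix an iteration of the for-loop and let `L` be the loads in the equilibrium that precedes it.
Regularity says that the marginal cost of a unit grows with the player's own load and with the total
load. After the demand of one player has grown, the total loads are `L` plus one unit on a single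
resource `r`, and every strategy is optimal against `L`. By the exchange property of polymatroids,
a player that can improve has a best response obtained by moving one of its units from `r` to some
`b`. Conversely, every best response at distance two moves a unit away from `r`. The result is again
optimal against `L`, and now `b` is the overloaded resource.

The costs of the units of a player, evaluated at total loads `L`, do not depend on the strategies of
the others, and each move replaces a unit by a strictly cheaper one. At most `m * δ` different costs
occur for each player, so the sum over all units of the ranks of their costs is less than
`(∑ i, d i) * m * δ` at the beginning and drops with each move. There are `∑ i, d i ≤ n * δ`
iterations of the for-loop.
-/
section AddSingle

variable {E : Type*} [DecidableEq E]

theorem add_single_apply (w : E → ℕ) (a e : E) :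
    (w + Pi.single a 1 : E → ℕ) e = w e + if e = a then 1 else 0 := by
  rw [Pi.add_apply, Pi.single_apply]

theorem exists_eq_add_single {x : E → ℕ} {a : E} (ha : 0 < x a) :
    ∃ w : E → ℕ, x = w + Pi.single a 1 := by
  refine ⟨x - Pi.single a 1, (tsub_add_cancel_of_le fun e => ?_).symm⟩
  rw [Pi.single_apply]
  split_ifs with h
  exacts [h ▸ ha, Nat.zero_le _]

theorem sum_add_single (w : E → ℕ) (a : E) (U : Finset E) :
    ∑ e ∈ U, (w + Pi.single a 1 : E → ℕ) e = ∑ e ∈ U, w e + if a ∈ U then 1 else 0 := by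
  simp only [add_single_apply, Finset.sum_add_distrib, Finset.sum_ite_eq']

variable [Fintype E]

theorem sum_apply_add_single {M : Type*} [AddCommMonoid M] {φ : E → ℕ → M} {w : E → ℕ} {a : E}
    {c : M} (h : φ a (w a + 1) = φ a (w a) + c) :
    ∑ e, φ e ((w + Pi.single a 1 : E → ℕ) e) = ∑ e, φ e (w e) + c := by
  have pointwise (e : E) :
      φ e ((w + Pi.single a 1 : E → ℕ) e) = φ e (w e) + if e = a then c else 0 := by
    rw [add_single_apply]
    split_ifs with he
    · rw [he, h]
    · simp only [add_zero]
  simp only [pointwise, Finset.sum_add_distrib, Finset.sum_ite_eq', Finset.mem_univ, if_true]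

theorem exists_eq_single_of_sum_eq_one {g : E → ℕ} (hg : ∑ e, g e = 1) :
    ∃ r, g = Pi.single r 1 := by
  obtain ⟨r, -, hr⟩ := Finset.exists_ne_zero_of_sum_ne_zero (hg ▸ one_ne_zero)
  obtain ⟨w, rfl⟩ := exists_eq_add_single (Nat.pos_of_ne_zero hr)
  have hw : ∑ e, w e = 0 := by
    rw [sum_add_single, if_pos (Finset.mem_univ r)] at hg
    exact Nat.add_right_cancel hg
  exact ⟨r, by rw [(Fintype.sum_eq_zero_iff_of_nonneg (zero_le : 0 ≤ w)).mp hw, zero_add]⟩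

theorem exists_eq_add_single_of_le {x y : E → ℕ} (hxy : x ≤ y)
    (hsum : ∑ e, y e = ∑ e, x e + 1) : ∃ r, y = x + Pi.single r 1 := by
  obtain ⟨g, rfl⟩ := exists_add_of_le hxy
  simp only [Pi.add_apply, Finset.sum_add_distrib] at hsum
  obtain ⟨r, rfl⟩ := exists_eq_single_of_sum_eq_one (Nat.add_left_cancel hsum)
  exact ⟨r, rfl⟩

end AddSingle

section L1Distance

variable {E : Type*} [Fintype E]

theorem l1Dist_add_two_mul_sum_inf (x y : E → ℕ) :
    l1Dist y x + 2 * ∑ e, ((x ⊓ y) e : ℤ) = ∑ e, (x e : ℤ) + ∑ e, (y e : ℤ) := by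
  rw [l1Dist, Finset.mul_sum, ← Finset.sum_add_distrib, ← Finset.sum_add_distrib]
  refine Finset.sum_congr rfl fun e _ => ?_
  rw [Pi.inf_apply]
  grind

variable [DecidableEq E]

theorem l1Dist_add_single_self (x : E → ℕ) (r : E) : l1Dist (x + Pi.single r 1) x = 1 := by
  simp [l1Dist, Pi.single_apply, apply_ite abs]

theorem l1Dist_add_single_add_single (w : E → ℕ) {a b : E} (hab : a ≠ b) :
    l1Dist (w + Pi.single b 1) (w + Pi.single a 1) = 2 := by
  have hinf : (w + Pi.single a 1) ⊓ (w + Pi.single b 1) = w := by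
    ext e
    simp only [Pi.inf_apply, add_single_apply]
    grind
  have h := l1Dist_add_two_mul_sum_inf (w + Pi.single a 1) (w + Pi.single b 1)
  simp only [hinf, ← Nat.cast_sum, sum_add_single, Finset.mem_univ, if_true] at h
  omega

theorem exists_eq_add_single_of_l1Dist_eq_one {x y : E → ℕ} (h : l1Dist y x = 1)
    (hsum : ∑ e, y e = ∑ e, x e + 1) : ∃ r, y = x + Pi.single r 1 := by
  have hdist := l1Dist_add_two_mul_sum_inf x y
  simp only [← Nat.cast_sum] at hdist
  have hinf : ∑ e, (x ⊓ y) e = ∑ e, x e := by omega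
  have hle : x ⊓ y = x := funext fun e =>
    (Finset.sum_eq_sum_iff_of_le fun e _ => inf_le_left (a := x) (b := y) e).mp hinf e
      (Finset.mem_univ e)
  exact exists_eq_add_single_of_le (inf_eq_left.mp hle) hsum

theorem exists_exchange_of_l1Dist_eq_two {x y : E → ℕ} (h : l1Dist y x = 2)
    (hsum : ∑ e, y e = ∑ e, x e) :
    ∃ (w : E → ℕ) (a b : E), a ≠ b ∧ x = w + Pi.single a 1 ∧ y = w + Pi.single b 1 := by
  have hdist := l1Dist_add_two_mul_sum_inf x y
  simp only [← Nat.cast_sum] at hdist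
  obtain ⟨a, ha⟩ := exists_eq_add_single_of_le (inf_le_left : x ⊓ y ≤ x) (by omega)
  obtain ⟨b, hb⟩ := exists_eq_add_single_of_le (inf_le_right : x ⊓ y ≤ y) (by omega)
  refine ⟨x ⊓ y, a, b, ?_, ha, hb⟩
  rintro rfl
  simp [l1Dist, ha.trans hb.symm] at h

end L1Distance

section Base

variable {E : Type*} [Fintype E] {f : Finset E → ℕ} {x z : E → ℕ} {d : ℕ}

theorem apply_le_of_mem_polymatroidBase (hx : x ∈ polymatroidBase f d) (e : E) : x e ≤ d :=
  (Finset.single_le_sum (fun _ _ => Nat.zero_le _) (Finset.mem_univ e)).trans_eq hx.2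

theorem finite_polymatroidBase (f : Finset E → ℕ) (d : ℕ) : (polymatroidBase f d).Finite :=
  (Set.Finite.pi' fun _ => Set.finite_Iic d).subset fun _ => apply_le_of_mem_polymatroidBase

theorem sum_le_min_of_mem_polymatroidBase (hx : x ∈ polymatroidBase f d) (U : Finset E) :
    ∑ e ∈ U, x e ≤ min (f U) d :=
  le_min (hx.1 U) (hx.2 ▸ Finset.sum_le_univ_sum_of_nonneg fun _ => Nat.zero_le _)

theorem eq_of_le_of_mem_polymatroidBase (hx : x ∈ polymatroidBase f d)
    (hz : z ∈ polymatroidBase f d) (hxz : x ≤ z) : x = z :=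
  funext fun e => (Finset.sum_eq_sum_iff_of_le fun e _ => hxz e).mp (hx.2.trans hz.2.symm) e
    (Finset.mem_univ e)

end Base

section Polymatroid

variable {E : Type*} [DecidableEq E] {f : Finset E → ℕ} {x z : E → ℕ} {d d' : ℕ}

namespace IsIntegralPolymatroidRank

theorem min_submodular (hf : IsIntegralPolymatroidRank f) (hd : d ≤ d') (U V : Finset E) :
    min (f (U ∪ V)) d + min (f (U ∩ V)) d' ≤ min (f U) d + min (f V) d' := by
  have hsub := hf.submodular U V
  have hU := hf.monotone _ _ (Finset.subset_union_left : U ⊆ U ∪ V)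
  have hV := hf.monotone _ _ (Finset.subset_union_right : V ⊆ U ∪ V)
  have hU' := hf.monotone _ _ (Finset.inter_subset_left : U ∩ V ⊆ U)
  have hV' := hf.monotone _ _ (Finset.inter_subset_right : U ∩ V ⊆ V)
  omega

theorem truncate (hf : IsIntegralPolymatroidRank f) (d : ℕ) :
    IsIntegralPolymatroidRank fun U => min (f U) d where
  normalized := by simp only [hf.normalized, zero_min]
  monotone U V h := min_le_min_right d (hf.monotone U V h)
  submodular := hf.min_submodular le_rfl

theorem tight_union_inter (hf : IsIntegralPolymatroidRank f) (hx : ∀ U, ∑ e ∈ U, x e ≤ f U)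
    {S T : Finset E} (hS : ∑ e ∈ S, x e = f S) (hT : ∑ e ∈ T, x e = f T) :
    ∑ e ∈ S ∪ T, x e = f (S ∪ T) ∧ ∑ e ∈ S ∩ T, x e = f (S ∩ T) := by
  have hsum := Finset.sum_union_inter (s₁ := S) (s₂ := T) (f := x)
  have hsub := hf.submodular S T
  have hunion := hx (S ∪ T)
  have hinter := hx (S ∩ T)
  omega

theorem tight_sup (hf : IsIntegralPolymatroidRank f) (hx : ∀ U, ∑ e ∈ U, x e ≤ f U)
    (𝒮 : Finset (Finset E)) (h𝒮 : ∀ S ∈ 𝒮, ∑ e ∈ S, x e = f S) :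
    ∑ e ∈ 𝒮.sup id, x e = f (𝒮.sup id) :=
  Finset.sup_induction (p := fun S => ∑ e ∈ S, x e = f S) (by simp [hf.normalized])
    (fun _ hS _ hT => (hf.tight_union_inter hx hS hT).1) h𝒮

theorem exists_greatest_tight_notMem [Finite E] (hf : IsIntegralPolymatroidRank f)
    (hx : ∀ U, ∑ e ∈ U, x e ≤ f U) (a : E) :
    ∃ S, a ∉ S ∧ ∑ e ∈ S, x e = f S ∧ ∀ U, ∑ e ∈ U, x e = f U → a ∉ U → U ⊆ S := by
  have := Fintype.ofFinite E
  let 𝒮 : Finset (Finset E) := {U | ∑ e ∈ U, x e = f U ∧ a ∉ U}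
  have h𝒮 (U : Finset E) : U ∈ 𝒮 ↔ ∑ e ∈ U, x e = f U ∧ a ∉ U := Finset.mem_filter_univ U
  refine ⟨𝒮.sup id, ?_, hf.tight_sup hx 𝒮 fun U hU => ((h𝒮 U).mp hU).1,
    fun U hU haU => Finset.le_sup (f := id) ((h𝒮 U).mpr ⟨hU, haU⟩)⟩
  simp only [Finset.mem_sup, id, not_exists, not_and]
  exact fun U hU => ((h𝒮 U).mp hU).2

variable [Fintype E]

theorem tight_inf (hf : IsIntegralPolymatroidRank f) (hx : ∀ U, ∑ e ∈ U, x e ≤ f U)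
    (hE : ∑ e, x e = f Finset.univ) (𝒮 : Finset (Finset E)) (h𝒮 : ∀ S ∈ 𝒮, ∑ e ∈ S, x e = f S) :
    ∑ e ∈ 𝒮.inf id, x e = f (𝒮.inf id) :=
  Finset.inf_induction (p := fun S => ∑ e ∈ S, x e = f S) hE
    (fun _ hS _ hT => (hf.tight_union_inter hx hS hT).2) h𝒮

theorem exists_least_tight_mem (hf : IsIntegralPolymatroidRank f)
    (hx : ∀ U, ∑ e ∈ U, x e ≤ f U) (hE : ∑ e, x e = f Finset.univ) (a : E) :
    ∃ T, a ∈ T ∧ ∑ e ∈ T, x e = f T ∧ ∀ U, ∑ e ∈ U, x e = f U → a ∈ U → T ⊆ U := by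
  let 𝒮 : Finset (Finset E) := {U | ∑ e ∈ U, x e = f U ∧ a ∈ U}
  have h𝒮 (U : Finset E) : U ∈ 𝒮 ↔ ∑ e ∈ U, x e = f U ∧ a ∈ U := Finset.mem_filter_univ U
  refine ⟨𝒮.inf id, ?_, hf.tight_inf hx hE 𝒮 fun U hU => ((h𝒮 U).mp hU).1,
    fun U hU haU => Finset.inf_le (f := id) ((h𝒮 U).mpr ⟨hU, haU⟩)⟩
  simp only [Finset.mem_inf, id]
  exact fun U hU => ((h𝒮 U).mp hU).2

end IsIntegralPolymatroidRank

section Exchange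

variable [Fintype E]

theorem add_single_mem_polymatroidBase {w : E → ℕ} {a b : E}
    (hw : w + Pi.single a 1 ∈ polymatroidBase f d)
    (htight : ∀ U, ∑ e ∈ U, (w + Pi.single a 1 : E → ℕ) e = min (f U) d → b ∈ U → a ∈ U) :
    w + Pi.single b 1 ∈ polymatroidBase f d := by
  refine ⟨fun U => ?_, ?_⟩
  · have hle := sum_le_min_of_mem_polymatroidBase hw U
    have hU := htight U
    rw [sum_add_single] at hle hU ⊢
    grind
  · rw [← hw.2, sum_add_single, sum_add_single, if_pos (Finset.mem_univ b),
      if_pos (Finset.mem_univ a)]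

theorem IsIntegralPolymatroidRank.exists_exchange (hf : IsIntegralPolymatroidRank f) (hd : d ≤ d')
    (hx : x ∈ polymatroidBase f d) (hz : z ∈ polymatroidBase f d') {a : E} (ha : z a < x a) :
    ∃ (b : E) (u v : E → ℕ), x b < z b ∧
      (x = u + Pi.single a 1 ∧ u + Pi.single b 1 ∈ polymatroidBase f d) ∧
      (z = v + Pi.single b 1 ∧ v + Pi.single a 1 ∈ polymatroidBase f d') := by
  have hxle := sum_le_min_of_mem_polymatroidBase hx
  have hzle := sum_le_min_of_mem_polymatroidBase hz
  have hzE : ∑ e, z e = min (f Finset.univ) d' :=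
    (hzle Finset.univ).antisymm (min_le_right _ _ |>.trans_eq hz.2.symm)
  obtain ⟨S, haS, hS, hSmax⟩ := (hf.truncate d).exists_greatest_tight_notMem hxle a
  obtain ⟨T, haT, hT, hTmin⟩ := (hf.truncate d').exists_least_tight_mem hzle hzE a
  obtain ⟨b, hbT, hbS, hb⟩ : ∃ b ∈ T, b ∉ S ∧ x b < z b := by
    by_contra! hle
    have hlt : ∑ e ∈ T \ S, z e < ∑ e ∈ T \ S, x e :=
      Finset.sum_lt_sum (fun e he => hle e (Finset.mem_sdiff.mp he).1 (Finset.mem_sdiff.mp he).2)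
        ⟨a, Finset.mem_sdiff.mpr ⟨haT, haS⟩, ha⟩
    have hxsplit : ∑ e ∈ T \ S, x e + ∑ e ∈ S, x e = ∑ e ∈ S ∪ T, x e := by
      rw [← Finset.sum_union Finset.sdiff_disjoint, Finset.sdiff_union_self_eq_union,
        Finset.union_comm]
    have hzsplit : ∑ e ∈ S ∩ T, z e + ∑ e ∈ T \ S, z e = ∑ e ∈ T, z e := by
      rw [Finset.inter_comm, Finset.sum_inter_add_sum_sdiff]
    have hsub := hf.min_submodular hd S T
    have hunion := hxle (S ∪ T)
    have hinter := hzle (S ∩ T)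
    omega
  obtain ⟨u, rfl⟩ := exists_eq_add_single (Nat.zero_lt_of_lt ha)
  obtain ⟨v, rfl⟩ := exists_eq_add_single (Nat.zero_lt_of_lt hb)
  refine ⟨b, u, v, hb, ⟨rfl, add_single_mem_polymatroidBase hx fun U hU hbU => ?_⟩, rfl,
    add_single_mem_polymatroidBase hz fun U hU haU => hTmin U hU haU hbT⟩
  by_contra haU
  exact hbS (hSmax U hU haU hbU)

theorem IsIntegralPolymatroidRank.exists_add_single_mem (hf : IsIntegralPolymatroidRank f)
    (hx : x ∈ polymatroidBase f d) (hd : d < f Finset.univ) :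
    ∃ r, x + Pi.single r 1 ∈ polymatroidBase f (d + 1) := by
  by_contra! hnot
  have htight (r : E) : ∃ U, r ∈ U ∧ ∑ e ∈ U, x e = f U := by
    by_contra! hU
    refine hnot r ⟨fun U => ?_, by rw [sum_add_single, hx.2, if_pos (Finset.mem_univ r)]⟩
    rw [sum_add_single]
    split_ifs with hr
    · exact (hx.1 U).lt_of_ne (hU U hr)
    · exact hx.1 U
  choose U hrU hU using htight
  have hcover : (Finset.univ.image U).sup id = Finset.univ :=
    Finset.eq_univ_of_forall fun r =>
      Finset.mem_sup.mpr ⟨U r, Finset.mem_image_of_mem U (Finset.mem_univ r), hrU r⟩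
  have hE := hf.tight_sup hx.1 (Finset.univ.image U) (by simpa using hU)
  rw [hcover, hx.2] at hE
  exact hd.ne hE

end Exchange

end Polymatroid

section SeparableCost

open scoped fwdDiff

variable {E : Type*} [Fintype E] {M : Type*} [AddCommGroup M]

/-- The separable cost `∑ e, φ e (x e)`. The cost functions `φ e` are discretely convex when their
marginals `Δ_[1] (φ e) u = φ e (u + 1) - φ e u` are monotone in `u`. -/
def separableCost (φ : E → ℕ → M) (x : E → ℕ) : M := ∑ e, φ e (x e)

theorem separableCost_add_single [DecidableEq E] (φ : E → ℕ → M) (w : E → ℕ) (a : E) :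
    separableCost φ (w + Pi.single a 1) = separableCost φ w + Δ_[1] (φ a) (w a) :=
  sum_apply_add_single (add_sub_cancel _ _).symm

/-- `x` minimizes the separable cost given by `φ` over the integral polymatroid base polyhedron
of `f`, truncated at `d`. -/
structure IsMinCostBase [LE M] (f : Finset E → ℕ) (d : ℕ) (φ : E → ℕ → M) (x : E → ℕ) : Prop where
  mem : x ∈ polymatroidBase f d
  cost_le : ∀ z ∈ polymatroidBase f d, separableCost φ x ≤ separableCost φ z

theorem isMinCostBase_zero [Preorder M] (f : Finset E → ℕ) (φ : E → ℕ → M) :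
    IsMinCostBase f 0 φ 0 := by
  have hmem : 0 ∈ polymatroidBase f 0 := ⟨fun U => by simp, by simp⟩
  refine ⟨hmem, fun z hz => ?_⟩
  rw [← eq_of_le_of_mem_polymatroidBase hmem hz zero_le]

variable [DecidableEq E] [LinearOrder M] [IsOrderedAddMonoid M] {f : Finset E → ℕ} {d d' : ℕ}
  {φ : E → ℕ → M} {x : E → ℕ}

theorem IsMinCostBase.fwdDiff_le {w : E → ℕ} {a b : E}
    (hw : IsMinCostBase f d φ (w + Pi.single a 1)) (hb : w + Pi.single b 1 ∈ polymatroidBase f d) :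
    Δ_[1] (φ a) (w a) ≤ Δ_[1] (φ b) (w b) := by
  simpa only [separableCost_add_single, add_le_add_iff_left] using hw.cost_le _ hb

-- A minimizer nearest to `x` works: an exchange towards `x` must not preserve minimality.
theorem exists_isMinCostBase_forall_exchange (hφ : ∀ e, Monotone (Δ_[1] (φ e)))
    (hf : IsIntegralPolymatroidRank f) (hd : d ≤ d') (hx : x ∈ polymatroidBase f d)
    (hne : (polymatroidBase f d').Nonempty) :
    ∃ y, IsMinCostBase f d' φ y ∧ ∀ a, y a < x a → ∃ (w : E → ℕ) (b : E),
      x = w + Pi.single a 1 ∧ w + Pi.single b 1 ∈ polymatroidBase f d ∧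
      Δ_[1] (φ b) (w b) < Δ_[1] (φ a) (y a) := by
  have hfin := finite_polymatroidBase f d'
  obtain ⟨y₀, hy₀, hmin⟩ := Set.exists_min_image _ (separableCost φ) hfin hne
  obtain ⟨y, hy, hnear⟩ := Set.exists_min_image {y | IsMinCostBase f d' φ y}
    (fun y => ∑ e, (x e - y e)) (hfin.subset fun _ hy => hy.mem) ⟨y₀, hy₀, hmin⟩
  refine ⟨y, hy, fun a ha => ?_⟩
  obtain ⟨b, u, v, hb, ⟨rfl, hu⟩, rfl, hv⟩ := hf.exists_exchange hd hx hy.mem ha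
  refine ⟨u, b, rfl, hu, ?_⟩
  have hba : b ≠ a := by
    rintro rfl
    exact hb.asymm ha
  simp only [add_single_apply, if_neg hba, if_neg hba.symm, if_true, add_zero] at ha hb ⊢
  by_contra! hle
  have hv_min : IsMinCostBase f d' φ (v + Pi.single a 1) := by
    refine ⟨hv, fun z hz => le_trans ?_ (hy.cost_le z hz)⟩
    rw [separableCost_add_single, separableCost_add_single, add_le_add_iff_left]
    exact hle.trans (hφ b (by omega))
  refine (hnear _ hv_min).not_gt (Finset.sum_lt_sum (fun e _ => ?_) ⟨a, Finset.mem_univ a, ?_⟩)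
  · simp only [add_single_apply]
    grind
  · simp only [add_single_apply, if_neg hba.symm, if_true]
    omega

theorem isMinCostBase_of_forall_fwdDiff_le (hφ : ∀ e, Monotone (Δ_[1] (φ e)))
    (hf : IsIntegralPolymatroidRank f) (hx : x ∈ polymatroidBase f d)
    (hloc : ∀ (w : E → ℕ) (a b : E), x = w + Pi.single a 1 →
      w + Pi.single b 1 ∈ polymatroidBase f d → Δ_[1] (φ a) (w a) ≤ Δ_[1] (φ b) (w b)) :
    IsMinCostBase f d φ x := by
  obtain ⟨y, hy, hex⟩ := exists_isMinCostBase_forall_exchange hφ hf le_rfl hx ⟨x, hx⟩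
  have hxy : x ≤ y := by
    intro a
    by_contra! ha
    obtain ⟨w, b, rfl, hb, hlt⟩ := hex a ha
    rw [add_single_apply, if_pos rfl, Nat.lt_add_one_iff] at ha
    exact ((hloc w a b rfl hb).trans_lt hlt).not_ge (hφ a ha)
  rwa [eq_of_le_of_mem_polymatroidBase hx hy.mem hxy]

theorem IsMinCostBase.exists_add_single (hφ : ∀ e, Monotone (Δ_[1] (φ e)))
    (hf : IsIntegralPolymatroidRank f) (hx : IsMinCostBase f d φ x) (hd : d < f Finset.univ) :
    ∃ r, IsMinCostBase f (d + 1) φ (x + Pi.single r 1) := by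
  obtain ⟨r, hr⟩ := hf.exists_add_single_mem hx.mem hd
  obtain ⟨y, hy, hex⟩ := exists_isMinCostBase_forall_exchange hφ hf d.le_succ hx.mem ⟨_, hr⟩
  have hxy : x ≤ y := by
    intro a
    by_contra! ha
    obtain ⟨w, b, rfl, hb, hlt⟩ := hex a ha
    rw [add_single_apply, if_pos rfl, Nat.lt_add_one_iff] at ha
    exact ((hx.fwdDiff_le hb).trans_lt hlt).not_ge (hφ a ha)
  obtain ⟨r, rfl⟩ := exists_eq_add_single_of_le hxy (by rw [hy.mem.2, hx.mem.2])
  exact ⟨r, hy⟩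

end SeparableCost

section LoadCost

open scoped fwdDiff

variable {E : Type*}

/-- The costs of a player as functions of its own load, when the loads of the others are `t`. -/
def loadCost (C : E → ℕ → ℕ → ℝ) (t : E → ℕ) : E → ℕ → ℝ := fun e u => C e u (t e)

variable {C : E → ℕ → ℕ → ℝ} {s t : E → ℕ}

theorem fwdDiff_loadCost_le {e : E} (hC : IsRegularCost (C e)) {u v : ℕ} (huv : u ≤ v)
    (h : u + t e ≤ v + s e) : Δ_[1] (loadCost C t e) u ≤ Δ_[1] (loadCost C s e) v := by
  have mono_load (u : ℕ) : Monotone fun t => leftDeriv (C e) (u + 1) t :=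
    monotone_nat_of_le_succ fun t => hC.mono (u + 1) t (Nat.le_add_left 1 u)
  have key : leftDeriv (C e) (u + 1) (t e) ≤ leftDeriv (C e) (v + 1) (s e) := by
    generalize s e = t' at h
    induction v, huv using Nat.le_induction generalizing t' with
    | base => exact mono_load u (Nat.add_le_add_iff_left.mp h)
    | succ v _ ih =>
      exact (ih (t' + 1) (by omega)).trans (hC.shift (v + 1) t' (Nat.le_add_left 1 v))
  exact key

theorem monotone_fwdDiff_loadCost (hC : ∀ e, IsRegularCost (C e)) (t : E → ℕ) (e : E) :
    Monotone (Δ_[1] (loadCost C t e)) :=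
  fun _ _ huv => fwdDiff_loadCost_le (hC e) huv (Nat.add_le_add_right huv _)

variable [Fintype E] [DecidableEq E] {f : Finset E → ℕ} {d d' : ℕ} {x : E → ℕ}

theorem IsMinCostBase.fwdDiff_loadCost_le (hC : ∀ e, IsRegularCost (C e)) {w : E → ℕ} {a b : E}
    (hw : IsMinCostBase f d (loadCost C s) (w + Pi.single a 1))
    (hb : w + Pi.single b 1 ∈ polymatroidBase f d) {u : ℕ} (hu : u ≤ w a)
    (ha : u + t a ≤ w a + s a) (hst : s ≤ t) :
    Δ_[1] (loadCost C t a) u ≤ Δ_[1] (loadCost C t b) (w b) :=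
  (_root_.fwdDiff_loadCost_le (hC a) hu ha).trans <| (hw.fwdDiff_le hb).trans <|
    _root_.fwdDiff_loadCost_le (hC b) le_rfl (Nat.add_le_add_left (hst b) _)

theorem IsMinCostBase.exists_exchange_of_load_le (hC : ∀ e, IsRegularCost (C e))
    (hf : IsIntegralPolymatroidRank f) (hx : IsMinCostBase f d (loadCost C s) x) {r : E}
    (hst : s ≤ t) (hts : t ≤ s + Pi.single r 1) (hnot : ¬ IsMinCostBase f d (loadCost C t) x) :
    ∃ (w : E → ℕ) (b : E), x = w + Pi.single r 1 ∧
      IsMinCostBase f d (loadCost C t) (w + Pi.single b 1) := by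
  obtain ⟨y, hy, hex⟩ := exists_isMinCostBase_forall_exchange (monotone_fwdDiff_loadCost hC t) hf
    le_rfl hx.mem ⟨x, hx.mem⟩
  have hdecr (a : E) (ha : y a < x a) : a = r ∧ x a = y a + 1 := by
    obtain ⟨w, b, rfl, hb, hlt⟩ := hex a ha
    have hload : w a + s a < y a + t a := by
      by_contra! hle
      refine hlt.not_ge (hx.fwdDiff_loadCost_le hC hb ?_ hle hst)
      rwa [add_single_apply, if_pos rfl, Nat.lt_add_one_iff] at ha
    have hta := hts a
    rw [add_single_apply] at ha hta ⊢
    grind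
  have hr : y r < x r := by
    by_contra! hr
    refine hnot ?_
    rwa [eq_of_le_of_mem_polymatroidBase hx.mem hy.mem fun a => ?_]
    by_contra! ha
    exact (hdecr a ha).1 ▸ ha |>.not_ge hr
  obtain ⟨w, rfl⟩ := exists_eq_add_single (Nat.zero_lt_of_lt hr)
  have hwy : w ≤ y := by
    intro a
    have ha := hdecr a
    rw [add_single_apply] at ha
    grind
  obtain ⟨b, rfl⟩ := exists_eq_add_single_of_le hwy <| by
    rw [hy.mem.2, ← hx.mem.2, sum_add_single, if_pos (Finset.mem_univ r)]
  exact ⟨w, b, rfl, hy⟩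

/-- `x` is an optimal strategy when the total loads, including `x` itself, are `L`. Where `x`
exceeds `L`, the truncated difference `L - x` means that there is no other load. -/
def IsStable (C : E → ℕ → ℕ → ℝ) (L : E → ℕ) (f : Finset E → ℕ) (d : ℕ) (x : E → ℕ) : Prop :=
  IsMinCostBase f d (loadCost C (L - x)) x

theorem IsStable.fwdDiff_le_fwdDiff {L w : E → ℕ} {a b : E} (hC : ∀ e, IsRegularCost (C e))
    (hf : IsIntegralPolymatroidRank f) (hd : d ≤ d') (hx : IsStable C L f d x)
    (hwx : w + Pi.single a 1 ≤ x + Pi.single b 1) (hwb : w b = x b + 1)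
    (hmem : w + Pi.single b 1 ∈ polymatroidBase f d') :
    Δ_[1] (loadCost C (L - (w + Pi.single a 1)) a) (w a) ≤
      Δ_[1] (loadCost C (L - (w + Pi.single a 1)) b) (w b) := by
  have hle (e : E) : w e + (if e = a then 1 else 0) ≤ x e + if e = b then 1 else 0 := by
    simpa only [add_single_apply] using hwx e
  have hab : a ≠ b := by
    rintro rfl
    have ha := hle a
    omega
  have ha : w a < x a := by
    simpa only [Nat.lt_iff_add_one_le, reduceIte, if_neg hab, add_zero] using hle a
  obtain ⟨h, u, -, hlt, ⟨rfl, hu⟩, -⟩ :=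
    hf.exists_exchange hd hx.mem hmem (a := a) (by rwa [add_single_apply, if_neg hab])
  obtain rfl : h = b := by
    by_contra hb
    have hh := hle h
    rw [add_single_apply w, if_neg hb] at hlt
    rw [if_neg hb] at hh
    omega
  rw [add_single_apply, if_pos rfl] at ha
  rw [add_single_apply, if_neg hab.symm] at hwb
  refine (_root_.fwdDiff_loadCost_le (hC a) (Nat.le_of_lt_succ ha) ?_).trans <|
    (hx.fwdDiff_le hu).trans <| _root_.fwdDiff_loadCost_le (hC h) (by omega) ?_
  all_goals simp only [Pi.sub_apply, add_single_apply, reduceIte, if_neg hab.symm]; omega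

theorem IsStable.add_single {L v : E → ℕ} {b : E} (hC : ∀ e, IsRegularCost (C e))
    (hf : IsIntegralPolymatroidRank f) (hd : d ≤ d') (hx : IsStable C L f d x) (hvx : v ≤ x)
    (hvb : v b = x b) (hy : IsMinCostBase f d' (loadCost C (L - v)) (v + Pi.single b 1)) :
    IsStable C L f d' (v + Pi.single b 1) := by
  refine isMinCostBase_of_forall_fwdDiff_le (monotone_fwdDiff_loadCost hC _) hf hy.mem
    fun w a c hw hc => ?_
  rcases eq_or_ne c b with rfl | hcb
  · rcases eq_or_ne a c with rfl | hac
    · exact le_rfl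
    · have hwc := congrFun hw c
      rw [add_single_apply, add_single_apply, if_pos rfl, if_neg hac.symm, hvb] at hwc
      rw [hw]
      exact hx.fwdDiff_le_fwdDiff hC hf hd (hw ▸ add_le_add_left hvx _) hwc.symm hc
  · refine (fwdDiff_loadCost_le (hC a) le_rfl ?_).trans <| ((hw ▸ hy).fwdDiff_le hc).trans <|
      fwdDiff_loadCost_le (hC c) le_rfl ?_
    all_goals simp only [Pi.sub_apply, add_single_apply, if_neg hcb]; omega

end LoadCost

section UnitPotential

open scoped fwdDiff

variable {E : Type*}

/-- The marginal cost of the unit number `u`, counted from `0`, of a player on `e`, when the loads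
of the others and the `u` lower units of the player add up to `L e`. -/
noncomputable def unitCost (C : E → ℕ → ℕ → ℝ) (L : E → ℕ) (e : E) (u : ℕ) : ℝ :=
  Δ_[1] (fun k => C e k (L e - u)) u

variable [Fintype E]

/-- The costs of all units that a player with demand at most `D` could use. -/
noncomputable def unitCosts (C : E → ℕ → ℕ → ℝ) (L : E → ℕ) (D : ℕ) : Finset ℝ :=
  (Finset.univ ×ˢ Finset.range D).image fun p => unitCost C L p.1 p.2

/-- The rank of a unit in the order of the costs of all units, ties having the same rank. -/
noncomputable def unitRank (C : E → ℕ → ℕ → ℝ) (L : E → ℕ) (D : ℕ) (e : E) (u : ℕ) : ℕ :=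
  (unitCosts C L D |>.filter (· < unitCost C L e u)).card

/-- The sum of the ranks of the units of the strategy `x`, which bounds the number of cost
decreasing exchanges that start from `x` while `L` is fixed. -/
noncomputable def unitPotential (C : E → ℕ → ℕ → ℝ) (L : E → ℕ) (D : ℕ) (x : E → ℕ) : ℕ :=
  ∑ e, ∑ u ∈ Finset.range (x e), unitRank C L D e u

variable {C : E → ℕ → ℕ → ℝ} {L : E → ℕ} {D : ℕ}

theorem unitCost_mem_unitCosts {e : E} {u : ℕ} (hu : u < D) :
    unitCost C L e u ∈ unitCosts C L D :=
  Finset.mem_image.mpr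
    ⟨(e, u), Finset.mk_mem_product (Finset.mem_univ e) (Finset.mem_range.mpr hu), rfl⟩

theorem unitRank_lt_card_mul {e : E} {u : ℕ} (hu : u < D) :
    unitRank C L D e u < Fintype.card E * D :=
  calc unitRank C L D e u
      < (unitCosts C L D).card := Finset.card_lt_card
        (Finset.filter_ssubset.mpr ⟨_, unitCost_mem_unitCosts hu, lt_irrefl _⟩)
    _ ≤ (Finset.univ ×ˢ Finset.range D : Finset (E × ℕ)).card := Finset.card_image_le
    _ = Fintype.card E * D := by rw [Finset.card_product, Finset.card_univ, Finset.card_range]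

theorem unitRank_lt_unitRank {a b : E} {u v : ℕ} (hu : u < D)
    (hlt : unitCost C L b u < unitCost C L a v) : unitRank C L D b u < unitRank C L D a v := by
  refine Finset.card_lt_card (Finset.ssubset_iff_of_subset ?_ |>.mpr
    ⟨unitCost C L b u, ?_, fun h => lt_irrefl _ (Finset.mem_filter.mp h).2⟩)
  · exact Finset.monotone_filter_right _ fun _ _ hc => hc.trans hlt
  · exact Finset.mem_filter.mpr ⟨unitCost_mem_unitCosts hu, hlt⟩

theorem unitPotential_add_sum_le {x : E → ℕ} (hx : ∀ e, x e ≤ D) :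
    unitPotential C L D x + ∑ e, x e ≤ (∑ e, x e) * (Fintype.card E * D) := by
  rw [unitPotential, ← Finset.sum_add_distrib, Finset.sum_mul]
  refine Finset.sum_le_sum fun e _ => ?_
  calc ∑ u ∈ Finset.range (x e), unitRank C L D e u + x e
      = ∑ u ∈ Finset.range (x e), (unitRank C L D e u + 1) := by
        rw [Finset.sum_add_distrib, Finset.sum_const, Finset.card_range, smul_eq_mul, mul_one]
    _ ≤ (Finset.range (x e)).card • (Fintype.card E * D) :=
        Finset.sum_le_card_nsmul _ _ _ fun u hu =>
          unitRank_lt_card_mul ((Finset.mem_range.mp hu).trans_le (hx e))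
    _ = x e * (Fintype.card E * D) := by rw [Finset.card_range, smul_eq_mul]

variable [DecidableEq E]

theorem unitPotential_add_single (w : E → ℕ) (a : E) :
    unitPotential C L D (w + Pi.single a 1) = unitPotential C L D w + unitRank C L D a (w a) :=
  sum_apply_add_single (φ := fun e k => ∑ u ∈ Finset.range k, unitRank C L D e u)
    (Finset.sum_range_succ _ _)

theorem unitPotential_add_single_lt {w : E → ℕ} {a b : E} (hb : w b < D)
    (hlt : unitCost C L b (w b) < unitCost C L a (w a)) :
    unitPotential C L D (w + Pi.single b 1) < unitPotential C L D (w + Pi.single a 1) := by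
  rw [unitPotential_add_single, unitPotential_add_single]
  exact Nat.add_lt_add_left (unitRank_lt_unitRank hb hlt) _

end UnitPotential

namespace PolymatroidGame

section Load

variable {N E : Type*} [Fintype N] [DecidableEq N]

theorem othersLoad_add (x : N → E → ℕ) (i : N) : othersLoad x i + x i = ∑ j, x j := by
  ext e
  rw [Finset.sum_apply]
  exact Finset.sum_erase_add _ _ (Finset.mem_univ i)

theorem othersLoad_eq_sub (x : N → E → ℕ) (i : N) : othersLoad x i = ∑ j, x j - x i :=
  eq_tsub_of_add_eq (othersLoad_add x i)

theorem othersLoad_update (x : N → E → ℕ) (i : N) (y : E → ℕ) :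
    othersLoad (Function.update x i y) i = othersLoad x i := by
  ext e
  refine Finset.sum_congr rfl fun j hj => ?_
  rw [Function.update_of_ne (Finset.ne_of_mem_erase hj)]

theorem sum_update (x : N → E → ℕ) (i : N) (y : E → ℕ) :
    ∑ j, Function.update x i y j = othersLoad x i + y := by
  rw [← othersLoad_add _ i, othersLoad_update, Function.update_self]

theorem sub_le_othersLoad {x : N → E → ℕ} {L : E → ℕ} (h : L ≤ ∑ j, x j) (i : N) :
    L - x i ≤ othersLoad x i :=
  (tsub_le_tsub_right h _).trans_eq (othersLoad_eq_sub x i).symm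

end Load

variable {N E : Type*} [Fintype N] [Fintype E] [DecidableEq E]

section BestResponse

variable [DecidableEq N] {G : PolymatroidGame N E} {s : State N E} {i : N}

theorem privateCost_update (i : N) (x : N → E → ℕ) (y : E → ℕ) :
    G.privateCost i (Function.update x i y) =
      separableCost (loadCost (G.C i) (othersLoad x i)) y := by
  rw [privateCost, othersLoad_update, Function.update_self]
  rfl

theorem isBestResponse_iff {k : ℕ} {x : N → E → ℕ} {y : E → ℕ} :
    G.IsBestResponse i k x y ↔
      IsMinCostBase (G.f i) k (loadCost (G.C i) (othersLoad x i)) y := by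
  simp only [IsBestResponse, privateCost_update]
  exact ⟨fun h => ⟨h.1, h.2⟩, fun h => ⟨h.mem, h.cost_le⟩⟩

theorem not_canImprove_iff (hx : s.x i ∈ polymatroidBase (G.f i) (s.dbar i)) :
    ¬ G.CanImprove s i ↔ G.IsBestResponse i (s.dbar i) s.x (s.x i) := by
  simp only [CanImprove, IsBestResponse, Function.update_eq_self, not_exists, not_and, not_lt, hx,
    true_and]

theorem CanImprove.separableCost_lt {y : E → ℕ} (hi : G.CanImprove s i)
    (hy : G.IsBestResponse i (s.dbar i) s.x y) :
    separableCost (loadCost (G.C i) (othersLoad s.x i)) y <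
      separableCost (loadCost (G.C i) (othersLoad s.x i)) (s.x i) := by
  obtain ⟨z, hz, hlt⟩ := hi
  rw [← privateCost_update]
  exact (hy.2 z hz).trans_lt hlt

end BestResponse

/-- The invariant of the algorithm after `k` iterations of the for-loop and `l` iterations of the
while-loop. The vector `L` stands for the loads in the equilibrium at the end of the previous
iteration of the for-loop. -/
structure Invariant (G : PolymatroidGame N E) (L : E → ℕ) (k l : ℕ) (s : State N E) : Prop where
  dbar_le : ∀ i, s.dbar i ≤ G.d i
  sum_dbar : ∑ i, s.dbar i = k
  load : ∑ i, s.x i = L ∨ ∃ r, ∑ i, s.x i = L + Pi.single r 1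
  stable : ∀ i, IsStable (G.C i) L (G.f i) (s.dbar i) (s.x i)
  potential_le : k + l + ∑ i, unitPotential (G.C i) L (Finset.univ.sup G.d) (s.x i) ≤
    k * ((∑ i, G.d i) * (Fintype.card E * Finset.univ.sup G.d))

namespace Invariant

variable {G : PolymatroidGame N E} {L : E → ℕ} {k l : ℕ} {s s' : State N E} {i : N}

theorem init (G : PolymatroidGame N E) : G.Invariant 0 0 0 ⟨fun _ => 0, fun _ _ => 0⟩ where
  dbar_le _ := Nat.zero_le _
  sum_dbar := Finset.sum_const_zero
  load := .inl Finset.sum_const_zero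
  stable _ := isMinCostBase_zero _ _
  potential_le := by simp [unitPotential]

theorem add_le (h : G.Invariant L k l s) :
    k + l ≤ Fintype.card N ^ 2 * Fintype.card E * Finset.univ.sup G.d ^ 3 := by
  have hd : ∑ i, G.d i ≤ Fintype.card N * Finset.univ.sup G.d :=
    Finset.sum_le_card_nsmul _ _ _ fun i hi => Finset.le_sup hi
  have hk : k ≤ ∑ i, G.d i := h.sum_dbar ▸ Finset.sum_le_sum fun i _ => h.dbar_le i
  calc k + l
      ≤ k * ((∑ i, G.d i) * (Fintype.card E * Finset.univ.sup G.d)) :=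
        le_self_add.trans h.potential_le
    _ ≤ (Fintype.card N * Finset.univ.sup G.d) *
          ((Fintype.card N * Finset.univ.sup G.d) * (Fintype.card E * Finset.univ.sup G.d)) := by
        gcongr
        exact hk.trans hd
    _ = Fintype.card N ^ 2 * Fintype.card E * Finset.univ.sup G.d ^ 3 := by ring

theorem exists_dbar_lt (h : G.Invariant L k l s) (hk : k < ∑ i, G.d i) :
    ∃ i, s.dbar i < G.d i := by
  obtain ⟨i, -, hi⟩ := Finset.exists_lt_of_sum_lt (h.sum_dbar.trans_lt hk)
  exact ⟨i, hi⟩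

variable [DecidableEq N]

theorem isPureNash (h : G.Invariant L (∑ i, G.d i) l s) (hno : ∀ i, ¬ G.CanImprove s i) :
    G.IsPureNash s.x := by
  intro i
  rw [← (Finset.sum_eq_sum_iff_of_le fun i _ => h.dbar_le i).mp h.sum_dbar i (Finset.mem_univ i)]
  exact (not_canImprove_iff (h.stable i).mem).mp (hno i)

theorem isMinCostBase (h : G.Invariant L k l s) (hi : ¬ G.CanImprove s i) :
    IsMinCostBase (G.f i) (s.dbar i) (loadCost (G.C i) (othersLoad s.x i)) (s.x i) :=
  isBestResponse_iff.mp ((not_canImprove_iff (h.stable i).mem).mp hi)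

theorem exists_increaseStep (h : G.Invariant L k l s) (hno : ¬ G.CanImprove s i)
    (hi : s.dbar i < G.d i) : ∃ s', G.IncreaseStep i s s' := by
  obtain ⟨r, hr⟩ := (h.isMinCostBase hno).exists_add_single
    (monotone_fwdDiff_loadCost (G.regular_C i) _) (G.rank_f i) (hi.trans_le (G.d_le i))
  exact ⟨_, hi, _, isBestResponse_iff.mpr hr, l1Dist_add_single_self _ r, rfl⟩

theorem exists_overloaded (h : G.Invariant L k l s) (hi : G.CanImprove s i) :
    ∃ r, ∑ j, s.x j = L + Pi.single r 1 := by
  refine h.load.resolve_left fun hL => ?_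
  refine (not_canImprove_iff (h.stable i).mem).mpr (isBestResponse_iff.mpr ?_) hi
  rw [othersLoad_eq_sub, hL]
  exact h.stable i

theorem exists_improveStep (h : G.Invariant L k l s) (hi : G.CanImprove s i) :
    ∃ s', G.ImproveStep i s s' := by
  obtain ⟨r, hr⟩ := h.exists_overloaded hi
  have hnot : ¬ IsMinCostBase (G.f i) (s.dbar i) (loadCost (G.C i) (othersLoad s.x i)) (s.x i) :=
    fun hmin => (not_canImprove_iff hmin.mem).mpr (isBestResponse_iff.mpr hmin) hi
  have hle : othersLoad s.x i ≤ L - s.x i + Pi.single r 1 := by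
    rw [othersLoad_eq_sub, hr, add_comm L, add_comm (L - s.x i)]
    exact add_tsub_le_assoc
  obtain ⟨w, b, hw, hb⟩ := (h.stable i).exists_exchange_of_load_le (G.regular_C i) (G.rank_f i)
    (sub_le_othersLoad (hr ▸ le_self_add) i) hle hnot
  have hrb : r ≠ b := by
    rintro rfl
    exact hnot (hw ▸ hb)
  exact ⟨_, hi, _, isBestResponse_iff.mpr hb, hw ▸ l1Dist_add_single_add_single w hrb, rfl⟩

theorem exists_exchange (h : G.Invariant L k l s) (hi : G.CanImprove s i) {y : E → ℕ}
    (hy : G.IsBestResponse i (s.dbar i) s.x y) (hdist : l1Dist y (s.x i) = 2) :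
    ∃ (w : E → ℕ) (a b : E), a ≠ b ∧ s.x i = w + Pi.single a 1 ∧ y = w + Pi.single b 1 ∧
      othersLoad s.x i + w = L ∧ unitCost (G.C i) L b (w b) < unitCost (G.C i) L a (w a) := by
  obtain ⟨r, hr⟩ := h.exists_overloaded hi
  obtain ⟨w, a, b, hab, hw, rfl⟩ := exists_exchange_of_l1Dist_eq_two hdist
    (hy.1.2.trans (h.stable i).mem.2.symm)
  have hstable : IsMinCostBase (G.f i) (s.dbar i) (loadCost (G.C i) (L - s.x i)) (s.x i) :=
    h.stable i
  have hle := sub_le_othersLoad (hr ▸ le_self_add) i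
  have hload := (othersLoad_add s.x i).trans hr
  have hlt := hi.separableCost_lt hy
  rw [hw] at hstable hle hload
  rw [hw, separableCost_add_single, separableCost_add_single, add_lt_add_iff_left] at hlt
  obtain rfl : a = r := by
    by_contra har
    refine hlt.not_ge (hstable.fwdDiff_loadCost_le (G.regular_C i) hy.1 le_rfl ?_ hle)
    have ha := congrFun hload a
    simp only [Pi.add_apply, Pi.sub_apply, Pi.single_apply, reduceIte, if_neg har] at ha ⊢
    omega
  have hL : othersLoad s.x i + w = L := by
    rwa [← add_assoc, add_left_inj] at hload
  rw [eq_tsub_of_add_eq hL] at hlt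
  exact ⟨w, a, b, hab, hw, rfl, hL, hlt⟩

theorem improve (h : G.Invariant L k l s) (hstep : G.ImproveStep i s s') :
    G.Invariant L k (l + 1) s' := by
  obtain ⟨hi, y, hy, hdist, rfl⟩ := hstep
  obtain ⟨w, a, b, hab, hw, rfl, hL, hlt⟩ := h.exists_exchange hi hy hdist
  have hstable : IsStable (G.C i) L (G.f i) (s.dbar i) (w + Pi.single b 1) := by
    refine (h.stable i).add_single (G.regular_C i) (G.rank_f i) le_rfl (hw ▸ le_self_add) ?_ ?_
    · rw [hw, add_single_apply, if_neg hab.symm, add_zero]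
    · exact eq_tsub_of_add_eq hL ▸ isBestResponse_iff.mp hy
  have hwb : w b < Finset.univ.sup G.d := calc
    w b < (w + Pi.single b 1 : E → ℕ) b := by rw [add_single_apply, if_pos rfl]; exact lt_add_one _
    _ ≤ s.dbar i := apply_le_of_mem_polymatroidBase hy.1 b
    _ ≤ G.d i := h.dbar_le i
    _ ≤ Finset.univ.sup G.d := Finset.le_sup (Finset.mem_univ i)
  have hpot_i := unitPotential_add_single_lt hwb hlt
  rw [← hw] at hpot_i
  have hpot := Finset.sum_lt_sum (s := Finset.univ)
    (fun j _ => (Function.forall_update_iff s.x (p := fun j x =>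
      unitPotential (G.C j) L (Finset.univ.sup G.d) x ≤
        unitPotential (G.C j) L (Finset.univ.sup G.d) (s.x j))).mpr
          ⟨hpot_i.le, fun _ _ => le_rfl⟩ j)
    ⟨i, Finset.mem_univ i, by rwa [Function.update_self]⟩
  have hle := h.potential_le
  exact
    { dbar_le := h.dbar_le
      sum_dbar := h.sum_dbar
      load := .inr ⟨b, by rw [sum_update, ← add_assoc, hL]⟩
      stable := (Function.forall_update_iff s.x
        (p := fun j x => IsStable (G.C j) L (G.f j) (s.dbar j) x)).mpr
          ⟨hstable, fun j _ => h.stable j⟩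
      potential_le := by
        dsimp only
        omega }

end Invariant

theorem sum_unitPotential_add_one_le {G : PolymatroidGame N E} {x : N → E → ℕ} {dbar : N → ℕ}
    (hmem : ∀ i, x i ∈ polymatroidBase (G.f i) (dbar i)) (hle : ∀ i, dbar i ≤ G.d i)
    (hpos : 0 < ∑ i, dbar i) (L : E → ℕ) :
    ∑ i, unitPotential (G.C i) L (Finset.univ.sup G.d) (x i) + 1 ≤
      (∑ i, G.d i) * (Fintype.card E * Finset.univ.sup G.d) := by
  have hx (i : N) (e : E) : x i e ≤ Finset.univ.sup G.d :=
    (apply_le_of_mem_polymatroidBase (hmem i) e).trans <|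
      (hle i).trans (Finset.le_sup (Finset.mem_univ i))
  calc ∑ i, unitPotential (G.C i) L (Finset.univ.sup G.d) (x i) + 1
      ≤ ∑ i, (unitPotential (G.C i) L (Finset.univ.sup G.d) (x i) + dbar i) := by
        rw [Finset.sum_add_distrib]
        exact Nat.add_le_add_left hpos _
    _ ≤ ∑ i, dbar i * (Fintype.card E * Finset.univ.sup G.d) :=
        Finset.sum_le_sum fun i _ => (hmem i).2 ▸ unitPotential_add_sum_le (hx i)
    _ ≤ (∑ i, G.d i) * (Fintype.card E * Finset.univ.sup G.d) := by
        rw [← Finset.sum_mul]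
        exact Nat.mul_le_mul_right _ (Finset.sum_le_sum fun i _ => hle i)

variable [DecidableEq N] {G : PolymatroidGame N E}

theorem Invariant.increase {L : E → ℕ} {k l : ℕ} {s s' : State N E} {i : N}
    (h : G.Invariant L k l s) (hno : ∀ j, ¬ G.CanImprove s j) (hstep : G.IncreaseStep i s s') :
    G.Invariant (∑ j, s.x j) (k + 1) l s' := by
  obtain ⟨hi, y, hy, hdist, rfl⟩ := hstep
  have hstable (j : N) : IsStable (G.C j) (∑ j, s.x j) (G.f j) (s.dbar j) (s.x j) := by
    rw [IsStable, ← othersLoad_eq_sub]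
    exact h.isMinCostBase (hno j)
  obtain ⟨r, rfl⟩ := exists_eq_add_single_of_l1Dist_eq_one hdist
    (by rw [hy.1.2, (h.stable i).mem.2])
  have hstable_i := (hstable i).add_single (G.regular_C i) (G.rank_f i) (s.dbar i).le_succ
    le_rfl rfl (othersLoad_eq_sub s.x i ▸ isBestResponse_iff.mp hy)
  have hstable' (j : N) : IsStable (G.C j) (∑ j, s.x j) (G.f j)
      (Function.update s.dbar i (s.dbar i + 1) j)
      (Function.update s.x i (s.x i + Pi.single r 1) j) := by
    rcases eq_or_ne j i with rfl | hj
    · rwa [Function.update_self, Function.update_self]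
    · rw [Function.update_of_ne hj, Function.update_of_ne hj]
      exact hstable j
  have hdbar : ∀ j, Function.update s.dbar i (s.dbar i + 1) j ≤ G.d j :=
    (Function.forall_update_iff s.dbar (p := fun j d => d ≤ G.d j)).mpr
      ⟨hi, fun j _ => h.dbar_le j⟩
  have hsum : ∑ j, Function.update s.dbar i (s.dbar i + 1) j = k + 1 := by
    have hupdate : Function.update s.dbar i (s.dbar i + 1) = s.dbar + Pi.single i 1 := by
      ext j
      rw [add_single_apply, Function.update_apply]
      grind
    rw [hupdate, sum_add_single, h.sum_dbar, if_pos (Finset.mem_univ i)]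
  refine ⟨hdbar, hsum, .inr ⟨r, ?_⟩, hstable', ?_⟩
  · rw [sum_update, ← add_assoc, othersLoad_add]
  · have hpot := sum_unitPotential_add_one_le (fun j => (hstable' j).mem) hdbar
      (hsum.symm ▸ k.succ_pos) (∑ j, s.x j)
    have hle := h.potential_le
    rw [add_one_mul]
    dsimp only at hpot ⊢
    omega

theorem Run.exists_invariant {k l : ℕ} {s : State N E} (h : G.Run k l s) :
    ∃ L, G.Invariant L k l s := by
  induction h with
  | init => exact ⟨0, Invariant.init G⟩
  | increase i _ hno _ hstep ih =>
    obtain ⟨L, hL⟩ := ih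
    exact ⟨_, hL.increase hno hstep⟩
  | improve i _ hstep ih =>
    obtain ⟨L, hL⟩ := ih
    exact ⟨L, hL.improve hstep⟩

end PolymatroidGame

theorem mainTheorem10 {N E : Type*} [Fintype N] [DecidableEq N] [Fintype E] [DecidableEq E]
    (G : PolymatroidGame N E) :
    -- the number of iterations (of the for-loop and of the while-loop together) is bounded
    (∀ (k l : ℕ) (s : PolymatroidGame.State N E), G.Run k l s →
      k + l ≤ Fintype.card N ^ 2 * Fintype.card E * (Finset.univ.sup G.d) ^ 3) ∧
    -- no execution gets stuck, whatever choices are made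
    (∀ (k l : ℕ) (s : PolymatroidGame.State N E), G.Run k l s →
      (∀ i, G.CanImprove s i → ∃ s', G.ImproveStep i s s') ∧
      ((∀ i, ¬ G.CanImprove s i) → k < ∑ i, G.d i →
        (∃ i, s.dbar i < G.d i) ∧
        ∀ i, s.dbar i < G.d i → ∃ s', G.IncreaseStep i s s')) ∧
    -- what is returned at the end of the for-loop is a pure Nash equilibrium
    (∀ (k l : ℕ) (s : PolymatroidGame.State N E), G.Run k l s →
      k = ∑ i, G.d i → (∀ i, ¬ G.CanImprove s i) → G.IsPureNash s.x) := by
  refine ⟨fun k l s h => ?_, fun k l s h => ⟨fun i hi => ?_, fun hno hk => ⟨?_, fun i hi => ?_⟩⟩,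
    fun k l s h hk hno => ?_⟩
  all_goals obtain ⟨L, hL⟩ := h.exists_invariant
  · exact hL.add_le
  · exact hL.exists_improveStep hi
  · exact hL.exists_dbar_lt hk
  · exact hL.exists_increaseStep (hno i) hi
  · exact (hk ▸ hL).isPureNash hno
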